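/- **Algebras.** A *DInFL-algebra* $\mathbf A=(A,\wedge,\vee,\cdot,1,\sim,-)$ is a distributive lattice $(A,\wedge,\vee)$ and a monoid $(A,\cdot,1)$ with unary operations $\sim,-$ such that $a\cdot b\le c\iff a\le -(b\cdot{\sim}c)\iff b\le{\sim}(-c\cdot a)$ for all $a,b,c\in A$. Put $a+b=-({\sim}b\cdot{\sim}a)$. A *DqRA* is a DInFL-algebra with a further unary operation $\neg$ such that $\neg\neg a=a$, $\neg(a\wedge b)=\neg a\vee\neg b$ and $\neg(a\cdot b)=\neg a+\neg b$. Homomorphisms preserve all the operations (lattice bounds are not in the signature). **Frames.** A *DInFL-frame* is a poset $(W,\preccurlyeq)$ with $I\subseteq W$, $\circ:W\times W\to\mathcal P(W)$ and ${}^\sim,{}^-:W\to W$ such that, where $U\circ V=\bigcup\{x\circ y\mid x\in U,\,y\in V\}$ for $U,V\subseteq W$ and points are identified with singletons, for all $u,v,x,y,z\in W$: (1) $x\preccurlyeq y\iff y\in I\circ x\iff y\in x\circ I$; (2) $x\preccurlyeq y$ and $x\in I$ imply $y\in I$; (3) $x\preccurlyeq y$ and $x\in u\circ v$ imply $y\in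 u\circ v$; (4) $(x\circ y)\circ z=x\circ(y\circ z)$; (5) $z^\sim\in x\circ y\iff y^-\in z\circ x$; (6) $x^{\sim-}\preccurlyeq x$ and $x^{-\sim}\preccurlyeq x$. A *DqRA-frame* has in addition ${}^\neg:W\to W$ with (7) $x^{\neg\neg}=x$; (8) $x\preccurlyeq y$ implies $y^\neg\preccurlyeq x^\neg$; (9) $z^-\in x\circ y\iff z^\neg\in y^{\sim\neg}\circ x^{\sim\neg}$. A frame is *doubly-pointed* if the poset has a least element $\bot$ and a greatest element $\top$ and $I$ is proper and non-empty. For $U\subseteq W$ put ${\sim}U=\{w\mid w^-\notin U\}$, $-U=\{w\mid w^\sim\notin U\}$ and $\neg U=\{w\mid w^\neg\notin U\}$. A *DInFL-frame morphism* is a map $f:W_1\to W_2$ such that: $x\preccurlyeq_1 y$ implies $f(x)\preccurlyeq_2 f(y)$; $z\in x\circ_1y$ implies $f(z)\in f(x)\circ_2f(y)$; if $f(z)\in u\circ_2v$, then there are $x,y\in W_1$ with $u\preccurlyeq_2f(x)$, $v\preccurlyeq_2f(y)$ and $z\in x\circ_1y$; $f(x^{\sim})=f(x)^{\sim}$; $f(x^{-})=f(x)^{-}$;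 and $I_1=f^{-1}[I_2]$. A *DqRA-frame morphism* satisfies in addition $f(x^{\neg})=f(x)^{\neg}$. **Spaces.** A *DInFL-space* is a doubly-pointed DInFL-frame with a compact topology such that whenever $x\not\preccurlyeq y$ there is a clopen up-set containing $x$ but not $y$; $I$ is clopen; and for all clopen proper non-empty up-sets $U,V$, the set $U\circ V$ is clopen, proper and non-empty, and ${\sim}U$ and $-U$ are clopen. A *DqRA-space* is a DInFL-space that is also a DqRA-frame and in which $\neg U$ is clopen for every clopen proper non-empty up-set $U$. A *DInFL-space* (*DqRA-space*) *morphism* is a continuous DInFL-frame (DqRA-frame) morphism that preserves $\bot$ and $\top$. **Duals.** For a DInFL-algebra $\mathbf A$, let $W_{\mathbf A}$ be the set of *generalised prime filters* of its lattice reduct, i.e. of all prime filters together with $\varnothing$ and $A$. Then $\mathfrak W(\mathbf A)$ is $W_{\mathbf A}$ ordered by inclusion, with $\bot=\varnothing$, $\top=A$, $I=\{F\mid 1\in F\}$, $F\circ G=\{H\mid a\cdot b\in H\text{ for all }a\in F,\,b\in G\}$, $F^\sim=\{{\sim}a\mid a\notin F\}$, $F^-=\{-a\mid a\notin F\}$,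 and the topology with subbasis $\{F\mid a\in F\}$, $\{F\mid a\notin F\}$ ($a\in A$). If $\mathbf A$ is a DqRA, $\mathfrak W_q(\mathbf A)$ also has $F^\neg=\{\neg a\mid a\notin F\}$. For a DInFL-space (DqRA-space) $\mathbb W$, $\mathfrak A(\mathbb W)$ (resp. $\mathfrak A_q(\mathbb W)$) is the set of clopen proper non-empty up-sets of $\mathbb W$ with the operations $\cap,\cup,\circ,I,\sim,-$ (resp. also $\neg$); it is a DInFL-algebra (resp. DqRA). **Theorem.** (i) Let $h:\mathbf A_1\to\mathbf A_2$ be a homomorphism of DInFL-algebras (of DqRAs). Then $\mathfrak W(\mathbf A_1)$ and $\mathfrak W(\mathbf A_2)$ are DInFL-spaces (resp. $\mathfrak W_q(\mathbf A_1)$ and $\mathfrak W_q(\mathbf A_2)$ are DqRA-spaces), and $F\mapsto h^{-1}(F)$ is a DInFL-space morphism $\mathfrak W(\mathbf A_2)\to\mathfrak W(\mathbf A_1)$ (resp. a DqRA-space morphism $\mathfrak W_q(\mathbf A_2)\to\mathfrak W_q(\mathbf A_1)$). (ii) Let $f:\mathbb W_1\to\mathbb W_2$ be a morphism of DInFL-spaces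 (of DqRA-spaces). Then $U\mapsto f^{-1}(U)$ is a DInFL-algebra homomorphism $\mathfrak A(\mathbb W_2)\to\mathfrak A(\mathbb W_1)$ (resp. a DqRA homomorphism $\mathfrak A_q(\mathbb W_2)\to\mathfrak A_q(\mathbb W_1)$). -/

import Mathlib

/-! ## Algebras -/

/-- A distributive involutive FL-algebra: a distributive lattice and a monoid (whose order is a
priori unrelated to the multiplication) with two linear negations `til` (written `∼`) and `mns`
(written `−`) such that
`a · b ≤ c ↔ a ≤ −(b · ∼c) ↔ b ≤ ∼(−c · a)`. -/
class DInFLAlgebra (A : Type*) extends DistribLattice A, Monoid A where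
  til : A → A
  mns : A → A
  res_left : ∀ a b c : A, a * b ≤ c ↔ a ≤ mns (b * til c)
  res_right : ∀ a b c : A, a * b ≤ c ↔ b ≤ til (mns c * a)

namespace DInFLAlgebra

/-- The dual operation `a + b = −(∼b · ∼a)`. -/
def dualMul {A : Type*} [DInFLAlgebra A] (a b : A) : A := mns (til b * til a)

variable {A : Type*} [DInFLAlgebra A]

theorem til_mns (a : A) : til (mns a) = a :=
  eq_of_forall_le_iff fun b => by simpa using (res_right 1 b a).symm

theorem mns_til (a : A) : mns (til a) = a :=
  eq_of_forall_le_iff fun b => by simpa using (res_left b 1 a).symm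

theorem mul_mono_left {a a' : A} (h : a ≤ a') (b : A) : a * b ≤ a' * b :=
  (res_left _ _ _).2 (h.trans ((res_left _ _ _).1 le_rfl))

theorem mul_mono_right (a : A) {b b' : A} (h : b ≤ b') : a * b ≤ a * b' :=
  (res_right _ _ _).2 (h.trans ((res_right _ _ _).1 le_rfl))

theorem mul_le_mns_one (a b : A) : a * b ≤ mns 1 ↔ a ≤ mns b := by
  rw [res_left, til_mns, mul_one]

theorem mul_le_til_one (a b : A) : a * b ≤ til 1 ↔ b ≤ til a := by
  rw [res_right, mns_til, one_mul]

theorem mns_anti {a b : A} (h : a ≤ b) : mns b ≤ mns a :=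
  (mul_le_mns_one _ _).1 ((mul_mono_right _ h).trans ((mul_le_mns_one _ _).2 le_rfl))

theorem til_anti {a b : A} (h : a ≤ b) : til b ≤ til a :=
  (mul_le_til_one _ _).1 ((mul_mono_left h _).trans ((mul_le_til_one _ _).2 le_rfl))

theorem til_inf (a b : A) : til (a ⊓ b) = til a ⊔ til b := by
  apply le_antisymm
  · rw [← til_mns (til a ⊔ til b)]
    apply til_anti
    apply le_inf
    · simpa [mns_til] using mns_anti (le_sup_left : til a ≤ til a ⊔ til b)
    · simpa [mns_til] using mns_anti (le_sup_right : til b ≤ til a ⊔ til b)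
  · exact sup_le (til_anti inf_le_left) (til_anti inf_le_right)

theorem mns_inf (a b : A) : mns (a ⊓ b) = mns a ⊔ mns b := by
  apply le_antisymm
  · rw [← mns_til (mns a ⊔ mns b)]
    apply mns_anti
    apply le_inf
    · simpa [til_mns] using til_anti (le_sup_left : mns a ≤ mns a ⊔ mns b)
    · simpa [til_mns] using til_anti (le_sup_right : mns b ≤ mns a ⊔ mns b)
  · exact sup_le (mns_anti inf_le_left) (mns_anti inf_le_right)

theorem til_sup (a b : A) : til (a ⊔ b) = til a ⊓ til b := by
  rw [← til_mns (til a ⊓ til b), mns_inf, mns_til, mns_til]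

theorem mns_sup (a b : A) : mns (a ⊔ b) = mns a ⊓ mns b := by
  rw [← mns_til (mns a ⊓ mns b), til_inf, til_mns, til_mns]

end DInFLAlgebra

/-- A distributive quasi relation algebra: a DInFL-algebra with a De Morgan negation `neg`
(written `¬`) such that `¬(a · b) = ¬a + ¬b`. -/
class DqRA (A : Type*) extends DInFLAlgebra A where
  neg : A → A
  neg_neg : ∀ a : A, neg (neg a) = a
  neg_inf : ∀ a b : A, neg (a ⊓ b) = neg a ⊔ neg b
  neg_mul : ∀ a b : A, neg (a * b) = DInFLAlgebra.dualMul (neg a) (neg b)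

theorem DqRA.neg_sup {A : Type*} [DqRA A] (a b : A) :
    DqRA.neg (a ⊔ b) = DqRA.neg a ⊓ DqRA.neg b := by
  rw [← DqRA.neg_neg (DqRA.neg a ⊓ DqRA.neg b), DqRA.neg_inf, DqRA.neg_neg, DqRA.neg_neg]

/-- Homomorphisms of DInFL-algebras. -/
structure IsDInFLHom {A B : Type*} [DInFLAlgebra A] [DInFLAlgebra B] (h : A → B) : Prop where
  map_inf : ∀ a b, h (a ⊓ b) = h a ⊓ h b
  map_sup : ∀ a b, h (a ⊔ b) = h a ⊔ h b
  map_mul : ∀ a b, h (a * b) = h a * h b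
  map_one : h 1 = 1
  map_til : ∀ a, h (DInFLAlgebra.til a) = DInFLAlgebra.til (h a)
  map_mns : ∀ a, h (DInFLAlgebra.mns a) = DInFLAlgebra.mns (h a)

/-- Homomorphisms of DqRAs. -/
structure IsDqRAHom {A B : Type*} [DqRA A] [DqRA B] (h : A → B) : Prop extends IsDInFLHom h where
  map_neg : ∀ a, h (DqRA.neg a) = DqRA.neg (h a)

/-! ## Frames and spaces -/

/-- The signature of DInFL-frames: a poset with a set `unit` (written `I`), a binary
set-operation `comp` (written `∘`) and unary operations `til` (`x ↦ x^∼`) and `mns` (`x ↦ x^−`).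
The laws are in `IsDInFLFrame`. -/
class DInFLFrameStruct (W : Type*) extends PartialOrder W where
  unit : Set W
  comp : W → W → Set W
  til : W → W
  mns : W → W

/-- The signature of DqRA-frames: `neg` is `x ↦ x^¬`. -/
class DqRAFrameStruct (W : Type*) extends DInFLFrameStruct W where
  neg : W → W

namespace Frame

open DInFLFrameStruct

variable {W : Type*} [DInFLFrameStruct W]

/-- `U ∘ V`, the union of all `x ∘ y` with `x ∈ U` and `y ∈ V`. -/
def setComp (U V : Set W) : Set W := {z | ∃ x ∈ U, ∃ y ∈ V, z ∈ comp x y}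

/-- `∼U = {w | w^− ∉ U}`. -/
def setTil (U : Set W) : Set W := {w | mns w ∉ U}

/-- `−U = {w | w^∼ ∉ U}`. -/
def setMns (U : Set W) : Set W := {w | til w ∉ U}

/-- `¬U = {w | w^¬ ∉ U}`. -/
def setNeg {W : Type*} [DqRAFrameStruct W] (U : Set W) : Set W :=
  {w | DqRAFrameStruct.neg w ∉ U}

end Frame

open DInFLFrameStruct in
/-- The laws of DInFL-frames. -/
class IsDInFLFrame (W : Type*) [DInFLFrameStruct W] : Prop where
  le_iff_left : ∀ x y : W, x ≤ y ↔ y ∈ Frame.setComp unit {x}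
  le_iff_right : ∀ x y : W, x ≤ y ↔ y ∈ Frame.setComp {x} unit
  unit_upper : ∀ x y : W, x ≤ y → x ∈ (unit : Set W) → y ∈ (unit : Set W)
  comp_upper : ∀ u v x y : W, x ≤ y → x ∈ comp u v → y ∈ comp u v
  comp_assoc : ∀ x y z : W, Frame.setComp (comp x y) {z} = Frame.setComp {x} (comp y z)
  rotate : ∀ x y z : W, til z ∈ comp x y ↔ mns y ∈ comp z x
  mns_til_le : ∀ x : W, mns (til x) ≤ x
  til_mns_le : ∀ x : W, til (mns x) ≤ x

open DInFLFrameStruct DqRAFrameStruct in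
/-- The laws of DqRA-frames. -/
class IsDqRAFrame (W : Type*) [DqRAFrameStruct W] : Prop extends IsDInFLFrame W where
  neg_neg : ∀ x : W, neg (neg x) = x
  neg_anti : ∀ x y : W, x ≤ y → neg y ≤ neg x
  comp_neg : ∀ x y z : W, mns z ∈ comp x y ↔ neg z ∈ comp (neg (til y)) (neg (til x))

open DInFLFrameStruct in
/-- A doubly-pointed DInFL-frame: a bounded DInFL-frame in which `I` is proper and non-empty. -/
class IsDoublyPointedDInFLFrame (W : Type*) [DInFLFrameStruct W] [BoundedOrder W] : Prop
    extends IsDInFLFrame W where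
  unit_nonempty : (unit : Set W).Nonempty
  unit_ne_univ : (unit : Set W) ≠ Set.univ

/-- `U` is a clopen proper non-empty up-set. -/
structure IsClopenProperUpset {W : Type*} [LE W] [TopologicalSpace W] (U : Set W) : Prop where
  isClopen : IsClopen U
  isUpperSet : IsUpperSet U
  nonempty : U.Nonempty
  ne_univ : U ≠ Set.univ

open DInFLFrameStruct in
/-- A DInFL-space: a doubly-pointed DInFL-frame with a compact totally order-disconnected topology
(`PriestleySpace` is total order-disconnectedness) such that `I` is clopen and, for all clopen
proper non-empty up-sets `U` and `V`, the set `U ∘ V` is clopen, proper and non-empty, and `∼U`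
and `−U` are clopen. Thus `∘` is an operation on the clopen proper non-empty up-sets; that `U ∘ V`
is proper and non-empty does not follow from its being clopen. -/
class IsDInFLSpace (W : Type*) [DInFLFrameStruct W] [BoundedOrder W] [TopologicalSpace W] : Prop
    extends IsDoublyPointedDInFLFrame W, CompactSpace W, PriestleySpace W where
  unit_clopen : IsClopen (unit : Set W)
  comp_clopen : ∀ U V : Set W, IsClopenProperUpset U → IsClopenProperUpset V →
    IsClopen (Frame.setComp U V)
  comp_nonempty : ∀ U V : Set W, IsClopenProperUpset U → IsClopenProperUpset V →
    (Frame.setComp U V).Nonempty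
  comp_ne_univ : ∀ U V : Set W, IsClopenProperUpset U → IsClopenProperUpset V →
    Frame.setComp U V ≠ Set.univ
  til_clopen : ∀ U : Set W, IsClopenProperUpset U → IsClopen (Frame.setTil U)
  mns_clopen : ∀ U : Set W, IsClopenProperUpset U → IsClopen (Frame.setMns U)

/-- A DqRA-space: a DInFL-space that is a DqRA-frame and in which `¬U` is clopen for every clopen
proper non-empty up-set `U`. -/
class IsDqRASpace (W : Type*) [DqRAFrameStruct W] [BoundedOrder W] [TopologicalSpace W] : Prop
    extends IsDInFLSpace W, IsDqRAFrame W where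
  neg_clopen : ∀ U : Set W, IsClopenProperUpset U → IsClopen (Frame.setNeg U)

open DInFLFrameStruct in
/-- Morphisms of DInFL-frames. -/
structure IsDInFLFrameMorphism {W₁ W₂ : Type*} [DInFLFrameStruct W₁] [DInFLFrameStruct W₂]
    (f : W₁ → W₂) : Prop where
  mono : ∀ x y, x ≤ y → f x ≤ f y
  forth : ∀ x y z, z ∈ comp x y → f z ∈ comp (f x) (f y)
  back : ∀ z u v, f z ∈ comp u v → ∃ x y, u ≤ f x ∧ v ≤ f y ∧ z ∈ comp x y
  map_til : ∀ x, f (til x) = til (f x)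
  map_mns : ∀ x, f (mns x) = mns (f x)
  preimage_unit : (unit : Set W₁) = f ⁻¹' (unit : Set W₂)

open DqRAFrameStruct in
/-- Morphisms of DqRA-frames. -/
structure IsDqRAFrameMorphism {W₁ W₂ : Type*} [DqRAFrameStruct W₁] [DqRAFrameStruct W₂]
    (f : W₁ → W₂) : Prop extends IsDInFLFrameMorphism f where
  map_neg : ∀ x, f (neg x) = neg (f x)

/-- Morphisms of DInFL-spaces: continuous frame morphisms that preserve the bounds. -/
structure IsDInFLSpaceMorphism {W₁ W₂ : Type*}
    [DInFLFrameStruct W₁] [BoundedOrder W₁] [TopologicalSpace W₁]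
    [DInFLFrameStruct W₂] [BoundedOrder W₂] [TopologicalSpace W₂]
    (f : W₁ → W₂) : Prop extends IsDInFLFrameMorphism f where
  continuous : Continuous f
  map_bot : f ⊥ = ⊥
  map_top : f ⊤ = ⊤

/-- Morphisms of DqRA-spaces: continuous DqRA-frame morphisms that preserve the bounds
(equivalently, DInFL-space morphisms that preserve `x ↦ x^¬`). -/
structure IsDqRASpaceMorphism {W₁ W₂ : Type*}
    [DqRAFrameStruct W₁] [BoundedOrder W₁] [TopologicalSpace W₁]
    [DqRAFrameStruct W₂] [BoundedOrder W₂] [TopologicalSpace W₂]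
    (f : W₁ → W₂) : Prop extends IsDInFLSpaceMorphism f, IsDqRAFrameMorphism f

/-! ## The dual space of an algebra -/

/-- A subset of a lattice is a generalised prime filter if it is a prime filter (a filter whose
complement is an ideal, so non-empty and proper), the whole lattice, or empty. -/
def IsGenPrimeFilter {A : Type*} [Lattice A] (F : Set A) : Prop :=
  (Order.IsPFilter F ∧ Order.IsIdeal Fᶜ) ∨ F = Set.univ ∨ F = ∅

theorem isGenPrimeFilter_iff {A : Type*} [Lattice A] (F : Set A) :
    IsGenPrimeFilter F ↔
      (∀ a b, a ⊓ b ∈ F ↔ a ∈ F ∧ b ∈ F) ∧ (∀ a b, a ⊔ b ∈ F ↔ a ∈ F ∨ b ∈ F) := by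
  constructor
  · rintro (⟨hF, hI⟩ | rfl | rfl)
    · have up : ∀ {a b : A}, a ≤ b → a ∈ F → b ∈ F := fun hab ha => hF.IsLowerSet hab ha
      refine ⟨fun a b => ⟨fun h => ⟨up inf_le_left h, up inf_le_right h⟩, ?_⟩,
        fun a b => ⟨?_, fun h => h.elim (up le_sup_left) (up le_sup_right)⟩⟩
      · rintro ⟨ha, hb⟩
        obtain ⟨c, hc, hac, hbc⟩ := hF.Directed _ ha _ hb
        exact up (le_inf hac hbc) hc
      · intro h
        by_contra! hab
        obtain ⟨c, hc, hac, hbc⟩ := hI.Directed a hab.1 b hab.2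
        exact hc (up (sup_le hac hbc) h)
    · simp
    · simp
  · rintro ⟨hi, hs⟩
    have up : ∀ {a b : A}, a ≤ b → a ∈ F → b ∈ F := fun {a b} hab ha =>
      ((hi a b).1 (by rwa [inf_eq_left.2 hab])).2
    rcases F.eq_empty_or_nonempty with h0 | h0
    · exact Or.inr (Or.inr h0)
    rcases Fᶜ.eq_empty_or_nonempty with h1 | h1
    · exact Or.inr (Or.inl (by simpa using h1))
    refine Or.inl ⟨Order.IsPFilter.of_def h0
      (fun a ha b hb => ⟨a ⊓ b, (hi a b).2 ⟨ha, hb⟩, inf_le_left, inf_le_right⟩) up,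
      ⟨fun a b hab ha hb => ha (up hab hb), h1, fun a ha b hb =>
        ⟨a ⊔ b, fun h => ((hs a b).1 h).elim ha hb, le_sup_left, le_sup_right⟩⟩⟩

/-- The set `W_A` of generalised prime filters of a lattice. -/
def GenPrimeFilter (A : Type*) [Lattice A] : Type _ := {F : Set A // IsGenPrimeFilter F}

namespace GenPrimeFilter

open DInFLAlgebra

/-- `X_a`, the set of generalised prime filters that contain `a`. -/
def X {A : Type*} [Lattice A] (a : A) : Set (GenPrimeFilter A) := {F | a ∈ F.1}

/-- The topology with subbasic open sets `X_a` and their complements. -/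
instance {A : Type*} [Lattice A] : TopologicalSpace (GenPrimeFilter A) :=
  TopologicalSpace.generateFrom (Set.range X ∪ Set.range fun a => (X a)ᶜ)

/-- `F^∼ = {∼a | a ∉ F}`. -/
def til {A : Type*} [DInFLAlgebra A] (F : GenPrimeFilter A) : GenPrimeFilter A :=
  ⟨{b | ∃ a, a ∉ F.1 ∧ DInFLAlgebra.til a = b}, by
    have key : ∀ b, b ∈ {b | ∃ a, a ∉ F.1 ∧ DInFLAlgebra.til a = b} ↔
        DInFLAlgebra.mns b ∉ F.1 := fun b =>
      ⟨by rintro ⟨a, ha, rfl⟩; rwa [mns_til], fun h => ⟨_, h, til_mns b⟩⟩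
    obtain ⟨hi, hs⟩ := (isGenPrimeFilter_iff _).1 F.2
    rw [isGenPrimeFilter_iff]
    simp only [key, mns_inf, mns_sup, hi, hs]
    exact ⟨fun a b => not_or, fun a b => not_and_or⟩⟩

/-- `F^− = {−a | a ∉ F}`. -/
def mns {A : Type*} [DInFLAlgebra A] (F : GenPrimeFilter A) : GenPrimeFilter A :=
  ⟨{b | ∃ a, a ∉ F.1 ∧ DInFLAlgebra.mns a = b}, by
    have key : ∀ b, b ∈ {b | ∃ a, a ∉ F.1 ∧ DInFLAlgebra.mns a = b} ↔
        DInFLAlgebra.til b ∉ F.1 := fun b =>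
      ⟨by rintro ⟨a, ha, rfl⟩; rwa [til_mns], fun h => ⟨_, h, mns_til b⟩⟩
    obtain ⟨hi, hs⟩ := (isGenPrimeFilter_iff _).1 F.2
    rw [isGenPrimeFilter_iff]
    simp only [key, til_inf, til_sup, hi, hs]
    exact ⟨fun a b => not_or, fun a b => not_and_or⟩⟩

/-- `F^¬ = {¬a | a ∉ F}`. -/
def neg {A : Type*} [DqRA A] (F : GenPrimeFilter A) : GenPrimeFilter A :=
  ⟨{b | ∃ a, a ∉ F.1 ∧ DqRA.neg a = b}, by
    have key : ∀ b, b ∈ {b | ∃ a, a ∉ F.1 ∧ DqRA.neg a = b} ↔ DqRA.neg b ∉ F.1 := fun b =>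
      ⟨by rintro ⟨a, ha, rfl⟩; rwa [DqRA.neg_neg], fun h => ⟨_, h, DqRA.neg_neg b⟩⟩
    obtain ⟨hi, hs⟩ := (isGenPrimeFilter_iff _).1 F.2
    rw [isGenPrimeFilter_iff]
    simp only [key, DqRA.neg_inf, DqRA.neg_sup, hi, hs]
    exact ⟨fun a b => not_or, fun a b => not_and_or⟩⟩

/-- The frame structure on the generalised prime filters of a DInFL-algebra: the order is
inclusion, `F ∈ I ↔ 1 ∈ F`, and `H ∈ F ∘ G ↔ F · G ⊆ H`. -/
instance {A : Type*} [DInFLAlgebra A] : DInFLFrameStruct (GenPrimeFilter A) where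
  le F G := F.1 ⊆ G.1
  le_refl F := Set.Subset.refl F.1
  le_trans _ _ _ := Set.Subset.trans
  le_antisymm _ _ h h' := Subtype.ext (Set.Subset.antisymm h h')
  unit := {F | (1 : A) ∈ F.1}
  comp F G := {H | ∀ a ∈ F.1, ∀ b ∈ G.1, a * b ∈ H.1}
  til := til
  mns := mns

instance {A : Type*} [DqRA A] : DqRAFrameStruct (GenPrimeFilter A) where
  neg := neg

/-- The bounds are the empty set and the whole algebra. -/
instance {A : Type*} [DInFLAlgebra A] : BoundedOrder (GenPrimeFilter A) where
  bot := ⟨∅, Or.inr (Or.inr rfl)⟩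
  top := ⟨Set.univ, Or.inr (Or.inl rfl)⟩
  bot_le F := Set.empty_subset F.1
  le_top F := Set.subset_univ F.1

/-- The dual `F ↦ h⁻¹(F)` of a homomorphism `h`. -/
def dualMap {A₁ A₂ : Type*} [DInFLAlgebra A₁] [DInFLAlgebra A₂] (h : A₁ → A₂)
    (hh : IsDInFLHom h) (F : GenPrimeFilter A₂) : GenPrimeFilter A₁ :=
  ⟨h ⁻¹' F.1, by
    obtain ⟨hi, hs⟩ := (isGenPrimeFilter_iff _).1 F.2
    rw [isGenPrimeFilter_iff]
    simp [Set.mem_preimage, hh.map_inf, hh.map_sup, hi, hs]⟩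

end GenPrimeFilter

/-! ## The dual algebra of a space -/

namespace Frame

open DInFLFrameStruct

variable {W : Type*} [DInFLFrameStruct W] [IsDInFLFrame W]

theorem le_iff_exists_left {x y : W} : x ≤ y ↔ ∃ i ∈ (unit : Set W), y ∈ comp i x := by
  rw [IsDInFLFrame.le_iff_left]; simp [setComp]

theorem le_iff_exists_right {x y : W} : x ≤ y ↔ ∃ i ∈ (unit : Set W), y ∈ comp x i := by
  rw [IsDInFLFrame.le_iff_right]; simp [setComp]

theorem mns_til (x : W) : mns (til x) = x := by
  refine le_antisymm (IsDInFLFrame.mns_til_le x) ?_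
  obtain ⟨i, hi, h⟩ := le_iff_exists_left.1 (le_refl (til x))
  exact le_iff_exists_right.2 ⟨i, hi, (IsDInFLFrame.rotate _ _ _).1 h⟩

theorem til_mns (x : W) : til (mns x) = x := by
  refine le_antisymm (IsDInFLFrame.til_mns_le x) ?_
  obtain ⟨i, hi, h⟩ := le_iff_exists_right.1 (le_refl (mns x))
  exact le_iff_exists_left.2 ⟨i, hi, (IsDInFLFrame.rotate _ _ _).2 h⟩

theorem mns_anti {x y : W} (hxy : x ≤ y) : mns y ≤ mns x := by
  obtain ⟨i, hi, h⟩ := le_iff_exists_left.1 hxy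
  rw [← til_mns y, IsDInFLFrame.rotate] at h
  exact le_iff_exists_right.2 ⟨i, hi, h⟩

theorem til_anti {x y : W} (hxy : x ≤ y) : til y ≤ til x := by
  obtain ⟨i, hi, h⟩ := le_iff_exists_right.1 hxy
  rw [← mns_til y, ← IsDInFLFrame.rotate] at h
  exact le_iff_exists_left.2 ⟨i, hi, h⟩

theorem setComp_assoc (U V T : Set W) :
    setComp (setComp U V) T = setComp U (setComp V T) := by
  ext w
  constructor
  · rintro ⟨p, ⟨x, hx, y, hy, hp⟩, z, hz, hw⟩
    have : w ∈ setComp {x} (comp y z) := by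
      rw [← IsDInFLFrame.comp_assoc]; exact ⟨p, hp, z, rfl, hw⟩
    obtain ⟨_, rfl, q, hq, hw'⟩ := this
    exact ⟨_, hx, q, ⟨y, hy, z, hz, hq⟩, hw'⟩
  · rintro ⟨x, hx, p, ⟨y, hy, z, hz, hp⟩, hw⟩
    have : w ∈ setComp (comp x y) {z} := by
      rw [IsDInFLFrame.comp_assoc]; exact ⟨x, rfl, p, hp, hw⟩
    obtain ⟨q, hq, _, rfl, hw'⟩ := this
    exact ⟨q, ⟨x, hx, y, hy, hq⟩, _, hz, hw'⟩

theorem unit_setComp {U : Set W} (hU : IsUpperSet U) : setComp unit U = U := by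
  ext w
  constructor
  · rintro ⟨i, hi, u, hu, hw⟩
    exact hU (le_iff_exists_left.2 ⟨i, hi, hw⟩) hu
  · intro hw
    obtain ⟨i, hi, h⟩ := le_iff_exists_left.1 (le_refl w)
    exact ⟨i, hi, w, hw, h⟩

theorem setComp_unit {U : Set W} (hU : IsUpperSet U) : setComp U unit = U := by
  ext w
  constructor
  · rintro ⟨u, hu, i, hi, hw⟩
    exact hU (le_iff_exists_right.2 ⟨i, hi, hw⟩) hu
  · intro hw
    obtain ⟨i, hi, h⟩ := le_iff_exists_right.1 (le_refl w)
    exact ⟨w, hw, i, hi, h⟩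

theorem setComp_subset_iff_left (T U V : Set W) :
    setComp T U ⊆ V ↔ T ⊆ setMns (setComp U (setTil V)) := by
  constructor
  · rintro h t ht ⟨u, hu, v, hv, hw⟩
    exact hv (h ⟨t, ht, u, hu, (by
      rwa [IsDInFLFrame.rotate] at hw)⟩)
  · rintro h w ⟨t, ht, u, hu, hw⟩
    by_contra hV
    refine h ht ⟨u, hu, til w, ?_, ?_⟩
    · change mns (til w) ∉ V
      rwa [mns_til]
    · rwa [IsDInFLFrame.rotate, mns_til]

theorem setComp_subset_iff_right (T U V : Set W) :
    setComp T U ⊆ V ↔ U ⊆ setTil (setComp (setMns V) T) := by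
  constructor
  · rintro h u hu ⟨v, hv, t, ht, hw⟩
    exact hv (h ⟨t, ht, u, hu, (by
      rwa [← IsDInFLFrame.rotate] at hw)⟩)
  · rintro h w ⟨t, ht, u, hu, hw⟩
    by_contra hV
    refine h hu ⟨mns w, ?_, t, ht, ?_⟩
    · change til (mns w) ∉ V
      rwa [til_mns]
    · rwa [← IsDInFLFrame.rotate, til_mns]

theorem mem_comp_iff_mns_mns (x y z : W) :
    z ∈ comp x y ↔ mns (mns z) ∈ comp (mns (mns x)) (mns (mns y)) := by
  have rot : ∀ a b c : W, c ∈ comp a b ↔ mns b ∈ comp (mns c) a := fun a b c => by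
    rw [← IsDInFLFrame.rotate, til_mns]
  rw [rot, rot, rot]

theorem setNeg_setComp {W : Type*} [DqRAFrameStruct W] [IsDqRAFrame W] (U V : Set W) :
    setNeg (setComp U V) = setMns (setComp (setTil (setNeg V)) (setTil (setNeg U))) := by
  have key : ∀ u v w : W, til w ∈ comp v u ↔ DqRAFrameStruct.neg w ∈
      comp (DqRAFrameStruct.neg (mns u)) (DqRAFrameStruct.neg (mns v)) := fun u v w => by
    rw [mem_comp_iff_mns_mns, mns_til, IsDqRAFrame.comp_neg, til_mns, til_mns]
  have mem : ∀ (S : Set W) (x : W), x ∈ setTil (setNeg S) ↔ DqRAFrameStruct.neg (mns x) ∈ S :=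
    fun S x => not_not
  ext w
  refine not_congr ⟨?_, ?_⟩
  · rintro ⟨u, hu, v, hv, h⟩
    have e : ∀ x : W, DqRAFrameStruct.neg (mns (til (DqRAFrameStruct.neg x))) = x := fun x => by
      rw [mns_til, IsDqRAFrame.neg_neg]
    refine ⟨til (DqRAFrameStruct.neg v), ?_, til (DqRAFrameStruct.neg u), ?_, ?_⟩
    · rwa [mem, e]
    · rwa [mem, e]
    · rwa [key, e, e]
  · rintro ⟨v, hv, u, hu, h⟩
    exact ⟨_, (mem U u).1 hu, _, (mem V v).1 hv, (key u v w).1 h⟩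

end Frame

namespace IsClopenProperUpset

open DInFLFrameStruct

section Bounds

variable {W : Type*} [DInFLFrameStruct W] [BoundedOrder W] [TopologicalSpace W]

theorem top_mem {U : Set W} (hU : IsClopenProperUpset U) : ⊤ ∈ U :=
  let ⟨_, hx⟩ := hU.nonempty
  hU.isUpperSet le_top hx

theorem bot_notMem {U : Set W} (hU : IsClopenProperUpset U) : ⊥ ∉ U := fun h =>
  hU.ne_univ (Set.eq_univ_of_forall fun _ => hU.isUpperSet bot_le h)

theorem of_top_bot {U : Set W} (h : IsClopen U) (h' : IsUpperSet U) (ht : ⊤ ∈ U) (hb : ⊥ ∉ U) :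
    IsClopenProperUpset U :=
  ⟨h, h', ⟨_, ht⟩, fun hu => hb (hu ▸ Set.mem_univ _)⟩

theorem inter {U V : Set W} (hU : IsClopenProperUpset U) (hV : IsClopenProperUpset V) :
    IsClopenProperUpset (U ∩ V) :=
  of_top_bot (hU.isClopen.inter hV.isClopen) (hU.isUpperSet.inter hV.isUpperSet)
    ⟨hU.top_mem, hV.top_mem⟩ fun h => hU.bot_notMem h.1

theorem union {U V : Set W} (hU : IsClopenProperUpset U) (hV : IsClopenProperUpset V) :
    IsClopenProperUpset (U ∪ V) :=
  of_top_bot (hU.isClopen.union hV.isClopen) (hU.isUpperSet.union hV.isUpperSet)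
    (Or.inl hU.top_mem) fun h => h.elim hU.bot_notMem hV.bot_notMem

/-- The preimage of a clopen proper non-empty up-set under a space morphism is again one. -/
theorem preimage {W₁ W₂ : Type*}
    [DInFLFrameStruct W₁] [BoundedOrder W₁] [TopologicalSpace W₁]
    [DInFLFrameStruct W₂] [BoundedOrder W₂] [TopologicalSpace W₂]
    {f : W₁ → W₂} (hf : IsDInFLSpaceMorphism f) {U : Set W₂} (hU : IsClopenProperUpset U) :
    IsClopenProperUpset (f ⁻¹' U) :=
  of_top_bot (hU.isClopen.preimage hf.continuous)
    (fun _ _ hab ha => hU.isUpperSet (hf.mono _ _ hab) ha)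
    (by rw [Set.mem_preimage, hf.map_top]; exact hU.top_mem)
    (by rw [Set.mem_preimage, hf.map_bot]; exact hU.bot_notMem)

end Bounds

variable {W : Type*} [DInFLFrameStruct W] [BoundedOrder W] [TopologicalSpace W] [IsDInFLSpace W]

theorem unit : IsClopenProperUpset (unit : Set W) :=
  ⟨IsDInFLSpace.unit_clopen, fun _ _ h h' => IsDInFLFrame.unit_upper _ _ h h',
    IsDoublyPointedDInFLFrame.unit_nonempty, IsDoublyPointedDInFLFrame.unit_ne_univ⟩

theorem setComp {U V : Set W} (hU : IsClopenProperUpset U) (hV : IsClopenProperUpset V) :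
    IsClopenProperUpset (Frame.setComp U V) :=
  ⟨IsDInFLSpace.comp_clopen U V hU hV,
    fun _ _ h ⟨x, hx, y, hy, hz⟩ => ⟨x, hx, y, hy, IsDInFLFrame.comp_upper _ _ _ _ h hz⟩,
    IsDInFLSpace.comp_nonempty U V hU hV, IsDInFLSpace.comp_ne_univ U V hU hV⟩

theorem mns_bot : DInFLFrameStruct.mns (⊥ : W) = ⊤ :=
  top_unique (by
    rw [← Frame.mns_til (⊤ : W)]; exact Frame.mns_anti bot_le)

theorem mns_top : DInFLFrameStruct.mns (⊤ : W) = ⊥ :=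
  bot_unique (by
    rw [← Frame.mns_til (⊥ : W)]; exact Frame.mns_anti le_top)

theorem til_bot : DInFLFrameStruct.til (⊥ : W) = ⊤ :=
  top_unique (by
    rw [← Frame.til_mns (⊤ : W)]; exact Frame.til_anti bot_le)

theorem til_top : DInFLFrameStruct.til (⊤ : W) = ⊥ :=
  bot_unique (by
    rw [← Frame.til_mns (⊥ : W)]; exact Frame.til_anti le_top)

theorem setTil {U : Set W} (hU : IsClopenProperUpset U) :
    IsClopenProperUpset (Frame.setTil U) :=
  of_top_bot (IsDInFLSpace.til_clopen U hU)
    (fun _ _ hab ha hb => ha (hU.isUpperSet (Frame.mns_anti hab) hb))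
    (by change DInFLFrameStruct.mns (⊤ : W) ∉ U; rw [mns_top]; exact hU.bot_notMem)
    (by change ¬ DInFLFrameStruct.mns (⊥ : W) ∉ U; rw [mns_bot]; exact not_not.2 hU.top_mem)

theorem setMns {U : Set W} (hU : IsClopenProperUpset U) :
    IsClopenProperUpset (Frame.setMns U) :=
  of_top_bot (IsDInFLSpace.mns_clopen U hU)
    (fun _ _ hab ha hb => ha (hU.isUpperSet (Frame.til_anti hab) hb))
    (by change DInFLFrameStruct.til (⊤ : W) ∉ U; rw [til_top]; exact hU.bot_notMem)
    (by change ¬ DInFLFrameStruct.til (⊥ : W) ∉ U; rw [til_bot]; exact not_not.2 hU.top_mem)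

theorem setNeg {W : Type*} [DqRAFrameStruct W] [BoundedOrder W] [TopologicalSpace W]
    [IsDqRASpace W] {U : Set W} (hU : IsClopenProperUpset U) :
    IsClopenProperUpset (Frame.setNeg U) := by
  have anti : ∀ {x y : W}, x ≤ y → DqRAFrameStruct.neg y ≤ DqRAFrameStruct.neg x :=
    fun h => IsDqRAFrame.neg_anti _ _ h
  have hb : DqRAFrameStruct.neg (⊥ : W) = ⊤ := top_unique (by
    rw [← IsDqRAFrame.neg_neg (⊤ : W)]; exact anti bot_le)
  have ht : DqRAFrameStruct.neg (⊤ : W) = ⊥ := bot_unique (by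
    rw [← IsDqRAFrame.neg_neg (⊥ : W)]; exact anti le_top)
  refine of_top_bot (IsDqRASpace.neg_clopen U hU)
    (fun _ _ hab ha hb => ha (hU.isUpperSet (anti hab) hb)) ?_ ?_
  · change DqRAFrameStruct.neg (⊤ : W) ∉ U
    rw [ht]; exact hU.bot_notMem
  · change ¬ DqRAFrameStruct.neg (⊥ : W) ∉ U
    rw [hb]; exact not_not.2 hU.top_mem

end IsClopenProperUpset

/-- The set of clopen proper non-empty up-sets of `W`. -/
def ClopenProperUpset (W : Type*) [LE W] [TopologicalSpace W] : Type _ :=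
  {U : Set W // IsClopenProperUpset U}

namespace ClopenProperUpset

/-- The lattice operations are intersection and union, so the order is inclusion. -/
instance {W : Type*} [DInFLFrameStruct W] [BoundedOrder W] [TopologicalSpace W] :
    DistribLattice (ClopenProperUpset W) :=
  Subtype.distribLattice (P := fun U : Set W => IsClopenProperUpset U)
    (fun _ _ hU hV => hU.union hV) (fun _ _ hU hV => hU.inter hV)

/-- The algebra of clopen proper non-empty up-sets of a DInFL-space, with the operations
`∩, ∪, ∘, I, ∼, −`. -/
instance {W : Type*} [DInFLFrameStruct W] [BoundedOrder W] [TopologicalSpace W] [IsDInFLSpace W] :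
    DInFLAlgebra (ClopenProperUpset W) where
  mul U V := ⟨Frame.setComp U.1 V.1, U.2.setComp V.2⟩
  one := ⟨DInFLFrameStruct.unit, IsClopenProperUpset.unit⟩
  til U := ⟨Frame.setTil U.1, U.2.setTil⟩
  mns U := ⟨Frame.setMns U.1, U.2.setMns⟩
  mul_assoc U V T := Subtype.ext (Frame.setComp_assoc U.1 V.1 T.1)
  one_mul U := Subtype.ext (Frame.unit_setComp U.2.isUpperSet)
  mul_one U := Subtype.ext (Frame.setComp_unit U.2.isUpperSet)
  res_left T U V := Frame.setComp_subset_iff_left T.1 U.1 V.1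
  res_right T U V := Frame.setComp_subset_iff_right T.1 U.1 V.1

/-- For a DqRA-space, the algebra also has the operation `¬`. -/
instance {W : Type*} [DqRAFrameStruct W] [BoundedOrder W] [TopologicalSpace W] [IsDqRASpace W] :
    DqRA (ClopenProperUpset W) where
  neg U := ⟨Frame.setNeg U.1, U.2.setNeg⟩
  neg_neg U := Subtype.ext (by
    ext w
    change ¬ ¬ DqRAFrameStruct.neg (DqRAFrameStruct.neg w) ∈ U.1 ↔ w ∈ U.1
    rw [not_not, IsDqRAFrame.neg_neg])
  neg_inf U V := Subtype.ext (Set.ext fun _ => not_and_or)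
  neg_mul U V := Subtype.ext (Frame.setNeg_setComp U.1 V.1)

/-- The dual `U ↦ f⁻¹(U)` of a space morphism `f`. -/
def dualMap {W₁ W₂ : Type*}
    [DInFLFrameStruct W₁] [BoundedOrder W₁] [TopologicalSpace W₁]
    [DInFLFrameStruct W₂] [BoundedOrder W₂] [TopologicalSpace W₂]
    (f : W₁ → W₂) (hf : IsDInFLSpaceMorphism f) (U : ClopenProperUpset W₂) :
    ClopenProperUpset W₁ :=
  ⟨f ⁻¹' U.1, U.2.preimage hf⟩

end ClopenProperUpset

/-! The algebra side rests on one extension principle, `exists_mem_comp`: if `P` and `Q` are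
filters, possibly empty, and `P · Q ⊆ H` for a generalised prime filter `H`, then `P` and `Q` can be
enlarged to generalised prime filters without losing the inclusion. It follows from the prime filter
theorem for distributive lattices, because residuation makes multiplication preserve binary joins in
each argument. The principle and its one-sided forms `exists_left` and `exists_right` supply every
point that has to exist: those in the unit laws, in associativity, in `X a ∘ X b = X (a * b)` and in
the back condition for `h⁻¹`. The laws on the unary operations are translations of residuation and
of `¬(a · b) = ¬a + ¬b`, since each operation on filters is a complement followed by a negation.

For the topology, an ultrafilter converges to the filter of those `a` for which it contains `X a`,
and compactness shows that the clopen proper non-empty up-sets are exactly the sets `X a`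
(`exists_eq_X`). With `∅` and `A` as points, no lattice bounds are needed.

On the space side, forth and back say that `f⁻¹` commutes with `∘` on up-sets; the other operations
commute with `f⁻¹` almost by definition. -/

namespace DInFLAlgebra

/-! ### Consequences of residuation. -/

variable {A : Type*} [DInFLAlgebra A]

theorem mul_le_mul_of_le {a a' b b' : A} (h : a ≤ a') (h' : b ≤ b') : a * b ≤ a' * b' :=
  (mul_mono_left h b).trans (mul_mono_right a' h')

/-- Left adjoints preserve joins; with its mirror image, this makes the sets in `exists_left` and
`exists_right` ideals. -/
theorem sup_mul_le {a a' b c : A} (h : a * b ≤ c) (h' : a' * b ≤ c) : (a ⊔ a') * b ≤ c :=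
  (res_left _ _ _).2 (sup_le ((res_left _ _ _).1 h) ((res_left _ _ _).1 h'))

theorem mul_sup_le {a b b' c : A} (h : a * b ≤ c) (h' : a * b' ≤ c) : a * (b ⊔ b') ≤ c :=
  (res_right _ _ _).2 (sup_le ((res_right _ _ _).1 h) ((res_right _ _ _).1 h'))

/-- Both ways of defining `a + b` by the linear negations agree. -/
theorem til_mns_mul_mns (a b : A) : til (mns b * mns a) = mns (til b * til a) :=
  eq_of_forall_le_iff fun x => by
    -- Residuation turns the two sides into `−a · x ≤ b` and `∼b ≤ ∼(−a · x)`, which are equivalent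
    -- because `∼` reverses the order and has inverse `−`.
    rw [← res_left, res_right, ← res_right]
    constructor
    · exact fun h => til_anti h
    · exact fun h => by simpa only [mns_til] using mns_anti h

end DInFLAlgebra

namespace GenPrimeFilter

open DInFLAlgebra

/-- An up-closed and meet-closed subset of a lattice, possibly empty. -/
structure IsGenFilter {A : Type*} [Lattice A] (P : Set A) : Prop where
  isUpperSet : IsUpperSet P
  inf_mem : ∀ a ∈ P, ∀ b ∈ P, a ⊓ b ∈ P

/-! ### Generalised prime filters and compactness. -/

section Lattice

variable {A : Type*} [Lattice A]

theorem inf_mem_iff (F : GenPrimeFilter A) {a b : A} : a ⊓ b ∈ F.1 ↔ a ∈ F.1 ∧ b ∈ F.1 :=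
  ((isGenPrimeFilter_iff _).1 F.2).1 a b

theorem sup_mem_iff (F : GenPrimeFilter A) {a b : A} : a ⊔ b ∈ F.1 ↔ a ∈ F.1 ∨ b ∈ F.1 :=
  ((isGenPrimeFilter_iff _).1 F.2).2 a b

theorem mem_of_le (F : GenPrimeFilter A) {a b : A} (h : a ≤ b) (ha : a ∈ F.1) : b ∈ F.1 :=
  (F.inf_mem_iff.1 ((inf_eq_left.2 h).symm ▸ ha)).2

theorem isGenFilter (F : GenPrimeFilter A) : IsGenFilter F.1 :=
  ⟨fun _ _ h ha => F.mem_of_le h ha, fun _ ha _ hb => F.inf_mem_iff.2 ⟨ha, hb⟩⟩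

theorem isGenFilter_Ici (a : A) : IsGenFilter (Set.Ici a) :=
  ⟨isUpperSet_Ici a, fun _ hb _ hc => le_inf hb hc⟩

theorem X_inf (a b : A) : X (a ⊓ b) = X a ∩ X b := Set.ext fun F => F.inf_mem_iff

theorem X_sup (a b : A) : X (a ⊔ b) = X a ∪ X b := Set.ext fun F => F.sup_mem_iff

theorem isClopen_X (a : A) : IsClopen (X a) :=
  ⟨isOpen_compl_iff.1 (TopologicalSpace.isOpen_generateFrom_of_mem (Or.inr ⟨a, rfl⟩)),
    TopologicalSpace.isOpen_generateFrom_of_mem (Or.inl ⟨a, rfl⟩)⟩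

theorem continuous_of_isClopen_preimage_X {Y : Type*} [TopologicalSpace Y]
    {f : Y → GenPrimeFilter A} (hf : ∀ a, IsClopen (f ⁻¹' X a)) : Continuous f := by
  refine continuous_generateFrom_iff.2 ?_
  rintro _ (⟨a, rfl⟩ | ⟨a, rfl⟩)
  · exact (hf a).isOpen
  · exact (hf a).compl.isOpen

/-- An ultrafilter `𝓕` converges to `{a | X a ∈ 𝓕}`: meets and joins pass through `X` and `𝓕`, and
as `∅` and the whole lattice are allowed, nothing else has to be checked. -/
instance compactSpace : CompactSpace (GenPrimeFilter A) := by
  refine ⟨isCompact_iff_ultrafilter_le_nhds.2 fun 𝓕 _ => ?_⟩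
  refine ⟨⟨{a | X a ∈ 𝓕}, (isGenPrimeFilter_iff _).2 ⟨fun a b => ?_, fun a b => ?_⟩⟩,
    Set.mem_univ _, ?_⟩
  · rw [Set.mem_ofPred_eq, X_inf]
    exact Filter.inter_mem_iff
  · rw [Set.mem_ofPred_eq, X_sup]
    exact Ultrafilter.union_mem_iff
  · refine le_of_le_of_eq (le_iInf₂ ?_) TopologicalSpace.nhds_generateFrom.symm
    rintro _ ⟨hF, ⟨a, rfl⟩ | ⟨a, rfl⟩⟩
    · exact Filter.le_principal_iff.2 hF
    · exact Filter.le_principal_iff.2 (Ultrafilter.compl_mem_iff_notMem.2 hF)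

end Lattice

/-- The prime filter theorem for generalised filters and ideals of a distributive lattice. -/
theorem exists_of_disjoint {A : Type*} [DistribLattice A] {P J : Set A} (hP : IsGenFilter P)
    (hJ : IsLowerSet J) (hJs : ∀ a ∈ J, ∀ b ∈ J, a ⊔ b ∈ J) (hPJ : Disjoint P J) :
    ∃ F : GenPrimeFilter A, P ⊆ F.1 ∧ Disjoint F.1 J := by
  -- The classical theorem needs a non-empty filter and a non-empty ideal; the two degenerate cases
  -- are answered by the improper points `∅` and `A`.
  rcases P.eq_empty_or_nonempty with rfl | hP0
  · exact ⟨⟨∅, Or.inr (Or.inr rfl)⟩, subset_rfl, Set.empty_disjoint J⟩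
  rcases J.eq_empty_or_nonempty with rfl | hJ0
  · exact ⟨⟨Set.univ, Or.inr (Or.inl rfl)⟩, Set.subset_univ P, Set.disjoint_empty _⟩
  have hF : Order.IsPFilter P := Order.IsPFilter.of_def hP0
    (fun a ha b hb => ⟨a ⊓ b, hP.inf_mem a ha b hb, inf_le_left, inf_le_right⟩)
    fun h ha => hP.isUpperSet h ha
  have hI : Order.IsIdeal J := ⟨hJ, hJ0,
    fun a ha b hb => ⟨a ⊔ b, hJs a ha b hb, le_sup_left, le_sup_right⟩⟩
  obtain ⟨K, hK, hJK, hPK⟩ := DistribLattice.prime_ideal_of_disjoint_filter_ideal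
    (F := hF.toPFilter) (I := hI.toIdeal) hPJ
  refine ⟨⟨(K : Set A)ᶜ, Or.inl ⟨hK.compl_filter, ?_⟩⟩, ?_, ?_⟩
  · rw [compl_compl]
    exact K.isIdeal
  · exact Set.subset_compl_iff_disjoint_right.2 hPK
  · exact Set.disjoint_compl_left_iff_subset.2 hJK

/-! ### Extension of filters, and the frame laws. -/

section DInFL

variable {A : Type*} [DInFLAlgebra A]

/-- The elements `a` with `a * b ∉ H` for some `b ∈ Q` form an ideal, possibly empty, that misses
`P`; a prime filter that separates `P` from it will do. The factor `Q` stays untouched, which the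
unit laws and associativity require, as one factor there is prescribed. -/
theorem exists_left {P Q : Set A} {H : GenPrimeFilter A} (hP : IsGenFilter P)
    (hQ : IsGenFilter Q) (h : ∀ a ∈ P, ∀ b ∈ Q, a * b ∈ H.1) :
    ∃ F : GenPrimeFilter A, P ⊆ F.1 ∧ ∀ a ∈ F.1, ∀ b ∈ Q, a * b ∈ H.1 := by
  have hJ : IsLowerSet {a | ∃ b ∈ Q, a * b ∉ H.1} := fun _ _ haa ⟨b, hb, hab⟩ =>
    ⟨b, hb, fun h => hab (H.mem_of_le (mul_mono_left haa b) h)⟩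
  have hJs : ∀ a ∈ {a | ∃ b ∈ Q, a * b ∉ H.1}, ∀ a' ∈ {a | ∃ b ∈ Q, a * b ∉ H.1},
      a ⊔ a' ∈ {a | ∃ b ∈ Q, a * b ∉ H.1} := by
    rintro a ⟨b, hb, hab⟩ a' ⟨b', hb', hab'⟩
    refine ⟨b ⊓ b', hQ.inf_mem b hb b' hb', fun h => ?_⟩
    -- A common `b ⊓ b'` serves both elements, and primeness of `H` splits the join on the right.
    have : (a ⊔ a') * (b ⊓ b') ≤ a * b ⊔ a' * b' :=
      sup_mul_le ((mul_mono_right a inf_le_left).trans le_sup_left)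
        ((mul_mono_right a' inf_le_right).trans le_sup_right)
    exact (H.sup_mem_iff.1 (H.mem_of_le this h)).elim hab hab'
  obtain ⟨F, hPF, hF⟩ := exists_of_disjoint hP hJ hJs
    (Set.disjoint_left.2 fun a ha ⟨b, hb, hab⟩ => hab (h a ha b hb))
  refine ⟨F, hPF, fun a ha b hb => ?_⟩
  by_contra hab
  exact Set.disjoint_left.1 hF ha ⟨b, hb, hab⟩

theorem exists_right {P Q : Set A} {H : GenPrimeFilter A} (hP : IsGenFilter P)
    (hQ : IsGenFilter Q) (h : ∀ a ∈ P, ∀ b ∈ Q, a * b ∈ H.1) :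
    ∃ G : GenPrimeFilter A, Q ⊆ G.1 ∧ ∀ a ∈ P, ∀ b ∈ G.1, a * b ∈ H.1 := by
  have hJ : IsLowerSet {b | ∃ a ∈ P, a * b ∉ H.1} := fun _ _ hbb ⟨a, ha, hab⟩ =>
    ⟨a, ha, fun h => hab (H.mem_of_le (mul_mono_right a hbb) h)⟩
  have hJs : ∀ b ∈ {b | ∃ a ∈ P, a * b ∉ H.1}, ∀ b' ∈ {b | ∃ a ∈ P, a * b ∉ H.1},
      b ⊔ b' ∈ {b | ∃ a ∈ P, a * b ∉ H.1} := by
    rintro b ⟨a, ha, hab⟩ b' ⟨a', ha', hab'⟩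
    refine ⟨a ⊓ a', hP.inf_mem a ha a' ha', fun h => ?_⟩
    have : (a ⊓ a') * (b ⊔ b') ≤ a * b ⊔ a' * b' :=
      mul_sup_le ((mul_mono_left inf_le_left b).trans le_sup_left)
        ((mul_mono_left inf_le_right b').trans le_sup_right)
    exact (H.sup_mem_iff.1 (H.mem_of_le this h)).elim hab hab'
  obtain ⟨G, hQG, hG⟩ := exists_of_disjoint hQ hJ hJs
    (Set.disjoint_left.2 fun b hb ⟨a, ha, hab⟩ => hab (h a ha b hb))
  refine ⟨G, hQG, fun a ha b hb => ?_⟩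
  by_contra hab
  exact Set.disjoint_left.1 hG hb ⟨a, ha, hab⟩

/-- If `P · Q ⊆ H` with `H` prime, then `P` and `Q` extend to generalised prime filters `F` and
`G` with `F · G ⊆ H`. -/
theorem exists_mem_comp {P Q : Set A} {H : GenPrimeFilter A} (hP : IsGenFilter P)
    (hQ : IsGenFilter Q) (h : ∀ a ∈ P, ∀ b ∈ Q, a * b ∈ H.1) :
    ∃ F G : GenPrimeFilter A, P ⊆ F.1 ∧ Q ⊆ G.1 ∧ H ∈ DInFLFrameStruct.comp F G := by
  obtain ⟨F, hPF, hF⟩ := exists_left hP hQ h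
  obtain ⟨G, hQG, hG⟩ := exists_right F.isGenFilter hQ hF
  exact ⟨F, G, hPF, hQG, hG⟩

theorem mem_til_iff {F : GenPrimeFilter A} {b : A} :
    b ∈ (DInFLFrameStruct.til F).1 ↔ DInFLAlgebra.mns b ∉ F.1 :=
  ⟨by rintro ⟨a, ha, rfl⟩; rwa [mns_til], fun h => ⟨_, h, til_mns b⟩⟩

theorem mem_mns_iff {F : GenPrimeFilter A} {b : A} :
    b ∈ (DInFLFrameStruct.mns F).1 ↔ DInFLAlgebra.til b ∉ F.1 :=
  ⟨by rintro ⟨a, ha, rfl⟩; rwa [til_mns], fun h => ⟨_, h, mns_til b⟩⟩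

/-- The generalised filter generated by the products of two generalised prime filters. -/
theorem isGenFilter_mul (F G : GenPrimeFilter A) :
    IsGenFilter {c | ∃ a ∈ F.1, ∃ b ∈ G.1, a * b ≤ c} where
  isUpperSet := fun _ _ h ⟨a, ha, b, hb, hab⟩ => ⟨a, ha, b, hb, hab.trans h⟩
  inf_mem := fun _ ⟨a, ha, b, hb, hab⟩ _ ⟨a', ha', b', hb', hab'⟩ =>
    ⟨a ⊓ a', F.inf_mem_iff.2 ⟨ha, ha'⟩, b ⊓ b', G.inf_mem_iff.2 ⟨hb, hb'⟩,
      le_inf ((mul_le_mul_of_le inf_le_left inf_le_left).trans hab)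
        ((mul_le_mul_of_le inf_le_right inf_le_right).trans hab')⟩

/-- Both bracketings are characterised by the same condition on triple products, so associativity of
`∘` is inherited from that of the multiplication. The intermediate point extends the filter
generated by `F · G`. -/
theorem mem_comp_comp_left {F G K H : GenPrimeFilter A} :
    H ∈ Frame.setComp (DInFLFrameStruct.comp F G) {K} ↔
      ∀ a ∈ F.1, ∀ b ∈ G.1, ∀ c ∈ K.1, a * b * c ∈ H.1 := by
  constructor
  · rintro ⟨L, hL, _, rfl, hH⟩ a ha b hb c hc
    exact hH _ (hL a ha b hb) c hc
  · intro h
    obtain ⟨L, hL, hH⟩ := exists_left (H := H) (isGenFilter_mul F G) K.isGenFilter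
      fun _ ⟨a, ha, b, hb, hd⟩ c hc => H.mem_of_le (mul_mono_left hd c) (h a ha b hb c hc)
    exact ⟨L, fun a ha b hb => hL ⟨a, ha, b, hb, le_rfl⟩, K, rfl, hH⟩

theorem mem_comp_comp_right {F G K H : GenPrimeFilter A} :
    H ∈ Frame.setComp {F} (DInFLFrameStruct.comp G K) ↔
      ∀ a ∈ F.1, ∀ b ∈ G.1, ∀ c ∈ K.1, a * b * c ∈ H.1 := by
  constructor
  · rintro ⟨_, rfl, L, hL, hH⟩ a ha b hb c hc
    rw [mul_assoc]
    exact hH a ha _ (hL b hb c hc)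
  · intro h
    obtain ⟨L, hL, hH⟩ := exists_right (H := H) F.isGenFilter (isGenFilter_mul G K)
      fun a ha _ ⟨b, hb, c, hc, hd⟩ =>
        H.mem_of_le (mul_mono_right a hd) (mul_assoc a b c ▸ h a ha b hb c hc)
    exact ⟨F, rfl, L, fun b hb c hc => hL ⟨b, hb, c, hc, le_rfl⟩, hH⟩

instance isDInFLFrame : IsDInFLFrame (GenPrimeFilter A) where
  le_iff_left F G := by
    constructor
    · intro h
      -- The unit point is a generalised prime extension of the principal filter of `1`, chosen so
      -- that its products with `F` stay in `G`.
      obtain ⟨E, hE, hG⟩ := exists_left (H := G) (isGenFilter_Ici (1 : A)) F.isGenFilter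
        fun a ha b hb => G.mem_of_le (by simpa using mul_mono_left ha b) (h hb)
      exact ⟨E, hE (le_refl (1 : A)), F, rfl, hG⟩
    · rintro ⟨E, hE, _, rfl, hG⟩ b hb
      simpa using hG 1 hE b hb
  le_iff_right F G := by
    constructor
    · intro h
      obtain ⟨E, hE, hG⟩ := exists_right (H := G) F.isGenFilter (isGenFilter_Ici (1 : A))
        fun a ha b hb => G.mem_of_le (by simpa using mul_mono_right a hb) (h ha)
      exact ⟨F, rfl, E, hE (le_refl (1 : A)), hG⟩
    · rintro ⟨_, rfl, E, hE, hG⟩ a ha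
      simpa using hG a ha 1 hE
  unit_upper _ _ h h1 := h h1
  comp_upper _ _ _ _ h hx a ha b hb := h (hx a ha b hb)
  comp_assoc _ _ _ := Set.ext fun _ => mem_comp_comp_left.trans mem_comp_comp_right.symm
  rotate F G K := by
    constructor
    · intro h c hc a ha
      refine mem_mns_iff.2 fun hb => mem_til_iff.1 (h a ha _ hb) ?_
      -- Residuating `c * a ≤ c * a` gives `c ≤ −(a · ∼(c · a))`.
      exact K.mem_of_le ((res_left _ _ _).1 le_rfl) hc
    · intro h a ha b hb
      refine mem_til_iff.2 fun hc => mem_mns_iff.1 (h _ hc a ha) ?_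
      -- Residuating `a * b ≤ a * b` gives `b ≤ ∼(−(a · b) · a)`.
      exact G.mem_of_le ((res_right _ _ _).1 le_rfl) hb
  mns_til_le F a ha := by
    rwa [mem_mns_iff, mem_til_iff, not_not, mns_til] at ha
  til_mns_le F a ha := by
    rwa [mem_til_iff, mem_mns_iff, not_not, til_mns] at ha

/-- The sets `X a` are the only clopen proper non-empty up-sets. -/
theorem exists_eq_X {U : Set (GenPrimeFilter A)} (hU : IsClopenProperUpset U) :
    ∃ a, U = X a := by
  have inner : ∀ F ∈ U, ∃ a ∈ F.1, X a ⊆ U := by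
    intro F hF
    -- Properness of `U` is used here: it excludes the point `∅`, so the directed cover below has a
    -- non-empty index set.
    have hFne : F.1.Nonempty := by
      by_contra! h
      exact hU.bot_notMem (hU.isUpperSet (show F ≤ ⊥ from h.le) hF)
    have : Nonempty F.1 := hFne.to_subtype
    -- A point outside `U` cannot contain `F`, so it omits some `a ∈ F`. These complements are
    -- directed through meets, hence a single one covers the compact set `Uᶜ`.
    obtain ⟨a, ha⟩ := hU.isClopen.compl.isClosed.isCompact.elim_directed_cover
      (fun a : F.1 => (X a.1)ᶜ) (fun a => (isClopen_X a.1).compl.isOpen)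
      (fun G hG => by
        have : ¬ F.1 ⊆ G.1 := fun h => hG (hU.isUpperSet (show F ≤ G from h) hF)
        obtain ⟨a, ha, haG⟩ := Set.not_subset.1 this
        exact Set.mem_iUnion.2 ⟨⟨a, ha⟩, haG⟩)
      (fun a b => ⟨⟨a.1 ⊓ b.1, F.inf_mem_iff.2 ⟨a.2, b.2⟩⟩,
        Set.compl_subset_compl.2 (by rw [X_inf]; exact Set.inter_subset_left),
        Set.compl_subset_compl.2 (by rw [X_inf]; exact Set.inter_subset_right)⟩)
    exact ⟨a.1, a.2, Set.compl_subset_compl.1 ha⟩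
  -- Non-emptiness of `U` plays the dual role: the point `A` lies in `U`, so some `X a₀` is
  -- contained in `U` and the family directed by joins is non-empty.
  obtain ⟨a₀, -, ha₀⟩ := inner ⊤ hU.top_mem
  have : Nonempty {a : A // X a ⊆ U} := ⟨⟨a₀, ha₀⟩⟩
  obtain ⟨a, ha⟩ := hU.isClopen.isClosed.isCompact.elim_directed_cover
    (fun a : {a : A // X a ⊆ U} => X a.1) (fun a => (isClopen_X a.1).isOpen)
    (fun F hF =>
      let ⟨a, haF, ha⟩ := inner F hF
      Set.mem_iUnion.2 ⟨⟨a, ha⟩, haF⟩)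
    (fun a b => ⟨⟨a.1 ⊔ b.1, by rw [X_sup]; exact Set.union_subset a.2 b.2⟩,
      Set.subset_union_left.trans (X_sup a.1 b.1).superset,
      Set.subset_union_right.trans (X_sup a.1 b.1).superset⟩)
  exact ⟨a.1, ha.antisymm a.2⟩

/-- If `a * b ∈ H`, then by monotonicity the principal filters of `a` and `b` multiply into `H`, and
they extend to points of `X a` and `X b`. -/
theorem setComp_X (a b : A) : Frame.setComp (X a) (X b) = X (a * b) := by
  ext H
  constructor
  · rintro ⟨F, hF, G, hG, hH⟩
    exact hH a hF b hG
  · intro h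
    obtain ⟨F, G, hF, hG, hH⟩ := exists_mem_comp (H := H) (isGenFilter_Ici a) (isGenFilter_Ici b)
      fun _ hc _ hd => H.mem_of_le (mul_le_mul_of_le hc hd) h
    exact ⟨F, hF (le_refl a), G, hG (le_refl b), hH⟩

theorem continuous_til :
    Continuous (DInFLFrameStruct.til : GenPrimeFilter A → GenPrimeFilter A) :=
  continuous_of_isClopen_preimage_X fun a => by
    convert (isClopen_X (DInFLAlgebra.mns a)).compl using 1
    exact Set.ext fun _ => mem_til_iff

theorem continuous_mns :
    Continuous (DInFLFrameStruct.mns : GenPrimeFilter A → GenPrimeFilter A) :=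
  continuous_of_isClopen_preimage_X fun a => by
    convert (isClopen_X (DInFLAlgebra.til a)).compl using 1
    exact Set.ext fun _ => mem_mns_iff

instance priestleySpace : PriestleySpace (GenPrimeFilter A) where
  priestley {F G} h := by
    obtain ⟨a, haF, haG⟩ := Set.not_subset.1 (show ¬ F.1 ⊆ G.1 from h)
    exact ⟨X a, isClopen_X a, fun _ _ h h' => h h', haF, haG⟩

instance isDInFLSpace : IsDInFLSpace (GenPrimeFilter A) where
  unit_nonempty := ⟨⊤, Set.mem_univ (1 : A)⟩
  unit_ne_univ h := Set.notMem_empty (1 : A)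
    (show (⊥ : GenPrimeFilter A) ∈ (DInFLFrameStruct.unit : Set (GenPrimeFilter A)) from
      h ▸ Set.mem_univ _)
  unit_clopen := isClopen_X (1 : A)
  comp_clopen U V hU hV := by
    obtain ⟨a, rfl⟩ := exists_eq_X hU
    obtain ⟨b, rfl⟩ := exists_eq_X hV
    rw [setComp_X]
    exact isClopen_X _
  comp_nonempty U V hU hV :=
    ⟨⊤, ⊤, hU.top_mem, ⊤, hV.top_mem, fun _ _ _ _ => Set.mem_univ _⟩
  comp_ne_univ U V hU hV h := by
    obtain ⟨a, rfl⟩ := exists_eq_X hU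
    obtain ⟨b, rfl⟩ := exists_eq_X hV
    rw [setComp_X] at h
    exact Set.notMem_empty (a * b) (show (⊥ : GenPrimeFilter A) ∈ X (a * b) from
      h ▸ Set.mem_univ _)
  -- By definition `∼U` is the preimage of `Uᶜ` under `F ↦ F^−`, so continuity of the opposite
  -- negation is what counts.
  til_clopen _ hU := hU.isClopen.compl.preimage continuous_mns
  mns_clopen _ hU := hU.isClopen.compl.preimage continuous_til

end DInFL

/-! ### The De Morgan negation on the dual space. -/

section DqRA

variable {A : Type*} [DqRA A]

theorem mem_neg_iff {F : GenPrimeFilter A} {b : A} :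
    b ∈ (DqRAFrameStruct.neg F).1 ↔ DqRA.neg b ∉ F.1 :=
  ⟨by rintro ⟨a, ha, rfl⟩; rwa [DqRA.neg_neg], fun h => ⟨_, h, DqRA.neg_neg b⟩⟩

theorem mem_neg_til_iff {F : GenPrimeFilter A} {b : A} :
    b ∈ (DqRAFrameStruct.neg (DInFLFrameStruct.til F)).1 ↔
      DInFLAlgebra.mns (DqRA.neg b) ∈ F.1 := by
  rw [mem_neg_iff, mem_til_iff, not_not]

theorem continuous_neg : Continuous (DqRAFrameStruct.neg : GenPrimeFilter A → GenPrimeFilter A) :=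
  continuous_of_isClopen_preimage_X fun a => by
    convert (isClopen_X (DqRA.neg a)).compl using 1
    exact Set.ext fun _ => mem_neg_iff

instance isDqRASpace : IsDqRASpace (GenPrimeFilter A) where
  neg_neg F := Subtype.ext (Set.ext fun a => by
    rw [mem_neg_iff, mem_neg_iff, not_not, DqRA.neg_neg])
  neg_anti F G h a ha := mem_neg_iff.2 fun h' => mem_neg_iff.1 ha (h h')
  comp_neg F G K := by
    -- The algebraic form of the frame law: the substitution `x ↦ −¬x` reverses products up to the
    -- outer negations. Its inverse is `x ↦ ¬∼x`, which supplies the witnesses in the converse.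
    have key : ∀ c d : A, DInFLAlgebra.til (DInFLAlgebra.mns (DqRA.neg d) *
        DInFLAlgebra.mns (DqRA.neg c)) = DqRA.neg (c * d) := fun c d => by
      rw [DqRA.neg_mul, til_mns_mul_mns, DInFLAlgebra.dualMul]
    constructor
    · intro h c hc d hd
      rw [mem_neg_iff, ← key, ← mem_mns_iff]
      exact h _ (mem_neg_til_iff.1 hd) _ (mem_neg_til_iff.1 hc)
    · intro h a ha b hb
      have e : ∀ x : A, DInFLAlgebra.mns (DqRA.neg (DqRA.neg (DInFLAlgebra.til x))) = x :=
        fun x => by rw [DqRA.neg_neg, mns_til]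
      have := h (DqRA.neg (DInFLAlgebra.til b)) (mem_neg_til_iff.2 (by rwa [e]))
        (DqRA.neg (DInFLAlgebra.til a)) (mem_neg_til_iff.2 (by rwa [e]))
      rwa [mem_neg_iff, ← key, e, e, ← mem_mns_iff] at this
  neg_clopen _ hU := hU.isClopen.compl.preimage continuous_neg

end DqRA

/-! ### Duals of homomorphisms. -/

section DualMap

variable {A₁ A₂ : Type*} [DInFLAlgebra A₁] [DInFLAlgebra A₂]

/-- The up-set generated by the image of a generalised prime filter under a homomorphism. -/
theorem isGenFilter_image {h : A₁ → A₂} (hh : IsDInFLHom h) (F : GenPrimeFilter A₁) :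
    IsGenFilter {c | ∃ a ∈ F.1, h a ≤ c} where
  isUpperSet := fun _ _ hcd ⟨a, ha, hac⟩ => ⟨a, ha, hac.trans hcd⟩
  inf_mem := fun _ ⟨a, ha, hac⟩ _ ⟨b, hb, hbd⟩ =>
    ⟨a ⊓ b, F.inf_mem_iff.2 ⟨ha, hb⟩, hh.map_inf a b ▸ inf_le_inf hac hbd⟩

theorem isDInFLSpaceMorphism_dualMap (h : A₁ → A₂) (hh : IsDInFLHom h) :
    IsDInFLSpaceMorphism (dualMap h hh) where
  mono _ _ hFG _ ha := hFG ha
  forth F G H hH a ha b hb := by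
    change h (a * b) ∈ H.1
    rw [hh.map_mul]
    exact hH _ ha _ hb
  -- The images of `F` and `G` generate filters whose products lie in `H`; extending them gives the
  -- required points.
  back H F G hH := by
    obtain ⟨F', G', hF, hG, hH'⟩ := exists_mem_comp (H := H) (isGenFilter_image hh F)
      (isGenFilter_image hh G) fun _ ⟨a, ha, hac⟩ _ ⟨b, hb, hbd⟩ =>
        H.mem_of_le (mul_le_mul_of_le hac hbd) (hh.map_mul a b ▸ hH a ha b hb)
    exact ⟨F', G', fun a ha => hF ⟨a, ha, le_rfl⟩, fun b hb => hG ⟨b, hb, le_rfl⟩, hH'⟩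
  map_til F := Subtype.ext (Set.ext fun a => by
    change h a ∈ (DInFLFrameStruct.til F).1 ↔ _
    rw [mem_til_iff, mem_til_iff, ← hh.map_mns]
    rfl)
  map_mns F := Subtype.ext (Set.ext fun a => by
    change h a ∈ (DInFLFrameStruct.mns F).1 ↔ _
    rw [mem_mns_iff, mem_mns_iff, ← hh.map_til]
    rfl)
  preimage_unit := Set.ext fun F => by
    change 1 ∈ F.1 ↔ h 1 ∈ F.1
    rw [hh.map_one]
  continuous := continuous_of_isClopen_preimage_X fun a => isClopen_X (h a)
  map_bot := rfl
  map_top := rfl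

end DualMap

theorem isDqRASpaceMorphism_dualMap {A₁ A₂ : Type*} [DqRA A₁] [DqRA A₂] (h : A₁ → A₂)
    (hh : IsDqRAHom h) : IsDqRASpaceMorphism (dualMap h hh.toIsDInFLHom) where
  toIsDInFLSpaceMorphism := isDInFLSpaceMorphism_dualMap h hh.toIsDInFLHom
  map_neg F := Subtype.ext (Set.ext fun a => by
    change h a ∈ (DqRAFrameStruct.neg F).1 ↔ _
    rw [mem_neg_iff, mem_neg_iff, ← hh.map_neg]
    rfl)

end GenPrimeFilter

/-! ### Duals of space morphisms. -/

namespace ClopenProperUpset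

theorem isDInFLHom_dualMap {W₁ W₂ : Type*}
    [DInFLFrameStruct W₁] [BoundedOrder W₁] [TopologicalSpace W₁] [IsDInFLSpace W₁]
    [DInFLFrameStruct W₂] [BoundedOrder W₂] [TopologicalSpace W₂] [IsDInFLSpace W₂]
    (f : W₁ → W₂) (hf : IsDInFLSpaceMorphism f) : IsDInFLHom (dualMap f hf) where
  map_inf _ _ := rfl
  map_sup _ _ := rfl
  map_mul U V := Subtype.ext (Set.ext fun z => by
    constructor
    · rintro ⟨u, hu, v, hv, hz⟩
      -- The back condition only gives `u ≤ f x` and `v ≤ f y`; this suffices because `U` and `V`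
      -- are up-sets.
      obtain ⟨x, y, hx, hy, hz'⟩ := hf.back z u v hz
      exact ⟨x, U.2.isUpperSet hx hu, y, V.2.isUpperSet hy hv, hz'⟩
    · rintro ⟨x, hx, y, hy, hz⟩
      exact ⟨f x, hx, f y, hy, hf.forth x y z hz⟩)
  map_one := Subtype.ext hf.preimage_unit.symm
  map_til U := Subtype.ext (Set.ext fun w => by
    change DInFLFrameStruct.mns (f w) ∉ U.1 ↔ f (DInFLFrameStruct.mns w) ∉ U.1
    rw [hf.map_mns])
  map_mns U := Subtype.ext (Set.ext fun w => by
    change DInFLFrameStruct.til (f w) ∉ U.1 ↔ f (DInFLFrameStruct.til w) ∉ U.1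
    rw [hf.map_til])

theorem isDqRAHom_dualMap {W₁ W₂ : Type*}
    [DqRAFrameStruct W₁] [BoundedOrder W₁] [TopologicalSpace W₁] [IsDqRASpace W₁]
    [DqRAFrameStruct W₂] [BoundedOrder W₂] [TopologicalSpace W₂] [IsDqRASpace W₂]
    (f : W₁ → W₂) (hf : IsDqRASpaceMorphism f) :
    IsDqRAHom (dualMap f hf.toIsDInFLSpaceMorphism) where
  toIsDInFLHom := isDInFLHom_dualMap f hf.toIsDInFLSpaceMorphism
  map_neg U := Subtype.ext (Set.ext fun w => by
    change DqRAFrameStruct.neg (f w) ∉ U.1 ↔ f (DqRAFrameStruct.neg w) ∉ U.1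
    rw [hf.map_neg])

end ClopenProperUpset

theorem mainTheorem11 :
    -- (i) a homomorphism `h` of DInFL-algebras
    (∀ {A₁ : Type*} {A₂ : Type*} [DInFLAlgebra A₁] [DInFLAlgebra A₂]
      (h : A₁ → A₂) (hh : IsDInFLHom h),
      IsDInFLSpace (GenPrimeFilter A₁) ∧ IsDInFLSpace (GenPrimeFilter A₂) ∧
        IsDInFLSpaceMorphism (GenPrimeFilter.dualMap h hh)) ∧
    -- (i) a homomorphism `h` of DqRAs
    (∀ {A₁ : Type*} {A₂ : Type*} [DqRA A₁] [DqRA A₂]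
      (h : A₁ → A₂) (hh : IsDqRAHom h),
      IsDqRASpace (GenPrimeFilter A₁) ∧ IsDqRASpace (GenPrimeFilter A₂) ∧
        IsDqRASpaceMorphism (GenPrimeFilter.dualMap h hh.toIsDInFLHom)) ∧
    -- (ii) a morphism `f` of DInFL-spaces
    (∀ {W₁ : Type*} {W₂ : Type*}
      [DInFLFrameStruct W₁] [BoundedOrder W₁] [TopologicalSpace W₁] [IsDInFLSpace W₁]
      [DInFLFrameStruct W₂] [BoundedOrder W₂] [TopologicalSpace W₂] [IsDInFLSpace W₂]
      (f : W₁ → W₂) (hf : IsDInFLSpaceMorphism f),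
      IsDInFLHom (ClopenProperUpset.dualMap f hf)) ∧
    -- (ii) a morphism `f` of DqRA-spaces
    (∀ {W₁ : Type*} {W₂ : Type*}
      [DqRAFrameStruct W₁] [BoundedOrder W₁] [TopologicalSpace W₁] [IsDqRASpace W₁]
      [DqRAFrameStruct W₂] [BoundedOrder W₂] [TopologicalSpace W₂] [IsDqRASpace W₂]
      (f : W₁ → W₂) (hf : IsDqRASpaceMorphism f),
      IsDqRAHom (ClopenProperUpset.dualMap f hf.toIsDInFLSpaceMorphism)) :=

  ⟨fun h hh => ⟨GenPrimeFilter.isDInFLSpace, GenPrimeFilter.isDInFLSpace,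
      GenPrimeFilter.isDInFLSpaceMorphism_dualMap h hh⟩,
    fun h hh => ⟨GenPrimeFilter.isDqRASpace, GenPrimeFilter.isDqRASpace,
      GenPrimeFilter.isDqRASpaceMorphism_dualMap h hh⟩,
    fun f hf => ClopenProperUpset.isDInFLHom_dualMap f hf,
    fun f hf => ClopenProperUpset.isDqRAHom_dualMap f hf⟩
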